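/- Let $S^1=\mathbb{R}/2\pi\mathbb{Z}$, and regard $L^2(S^1;\mathbb{C})$ as a real Hilbert space with inner product $(f,g)=\mathrm{Re}\int_{S^1}f\bar g\,dt$. For $c=\sum_{l\in\mathbb{Z}}c_le^{ilt}\in L^2(S^1;\mathbb{C})$ put $c^{aps}=\sum_{l\in\mathbb{Z}}\operatorname{sign}(l)\,c_le^{ilt}$, where $\operatorname{sign}(l)=1,0,-1$ according as $l>0$, $l=0$, $l<0$. Theorem. Let $d^+,d^-:S^1\to\mathbb{C}$ be functions of class $C^1$ such that $|d^+(t)|^2+|d^-(t)|^2\neq 0$ for every $t\in S^1$. Then the bounded real-linear operator $$\mathcal{T}_{d^+,d^-}:L^2(S^1;\mathbb{C})\to L^2(S^1;\mathbb{C}),\qquad \mathcal{T}_{d^+,d^-}(c)=\overline{d^-}\,c-d^+\,\overline{c^{aps}},$$ is a Fredholm operator, and its index $\dim_{\mathbb{R}}\ker\mathcal{T}_{d^+,d^-}-\dim_{\mathbb{R}}\operatorname{coker}\mathcal{T}_{d^+,d^-}$ equals $0$. -/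

import Mathlib

open MeasureTheory
open scoped Real ENNReal

namespace CircleOperator

/-- The circle `S¹ = ℝ / 2πℤ`, with coordinate `t`. -/
abbrev S1 : Type := AddCircle (2 * π)

instance : Fact (0 < 2 * π) := ⟨Real.two_pi_pos⟩

/-- The normalised rotation invariant measure `dt / 2π` on the circle. -/
noncomputable abbrev μ : Measure S1 := AddCircle.haarAddCircle

/-- `L²(S¹; ℂ)`; below it is mostly regarded as a real vector space. -/
noncomputable abbrev L2 : Type := Lp ℂ 2 μ

/-- `d` is of class `C¹` on the circle: its `2π`-periodic lift `t ↦ d(t)` is `C¹` on `ℝ`. -/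
def IsC1 (d : C(S1, ℂ)) : Prop := ContDiff ℝ 1 (fun t : ℝ => d (t : S1))

lemma norm_sign_mul_le (p : ℤ → ℂ) (l : ℤ) : ‖(l.sign : ℂ) * p l‖ ≤ ‖p l‖ := by
  rcases lt_trichotomy l 0 with h | h | h
  · simp [Int.sign_eq_neg_one_of_neg h]
  · simp [h]
  · simp [Int.sign_eq_one_of_pos h]

lemma memlp_sign_mul (p : lp (fun _ : ℤ => ℂ) 2) :
    Memℓp (fun l : ℤ => (l.sign : ℂ) * p l) 2 := by
  exact (lp.memℓp p).mono' (norm_sign_mul_le p)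

/-- The diagonal operator `(p_l) ↦ (sign(l) p_l)` on `ℓ²(ℤ; ℂ)`, with `sign(0) = 0`. -/
noncomputable def signMul :
    lp (fun _ : ℤ => ℂ) 2 →L[ℂ] lp (fun _ : ℤ => ℂ) 2 :=
  LinearMap.mkContinuous
    { toFun := fun p => ⟨fun l => (l.sign : ℂ) * p l, memlp_sign_mul p⟩
      map_add' := fun p q => by
        ext l
        exact mul_add _ _ _
      map_smul' := fun a p => by
        ext l
        exact mul_left_comm _ _ _ }
    1 fun p => by
      rw [one_mul]
      exact lp.norm_mono two_ne_zero (norm_sign_mul_le p)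

/-- The operator `c = ∑ c_l e^{ilt} ↦ c^{aps} = ∑ sign(l) c_l e^{ilt}` on `L²(S¹; ℂ)`. -/
noncomputable def aps : L2 →L[ℂ] L2 :=
  (fourierBasis.repr.symm.toContinuousLinearEquiv.toContinuousLinearMap :
      lp (fun _ : ℤ => ℂ) 2 →L[ℂ] L2) ∘L signMul ∘L
    (fourierBasis.repr.toContinuousLinearEquiv.toContinuousLinearMap :
      L2 →L[ℂ] lp (fun _ : ℤ => ℂ) 2)

/-- Pointwise multiplication by a continuous function `d`, on `L²(S¹; ℂ)`. -/
noncomputable def mulOp (d : C(S1, ℂ)) : L2 →L[ℝ] L2 :=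
  (ContinuousLinearMap.mul ℝ ℂ).holderL μ ∞ 2 2 (ContinuousMap.toLp ∞ μ ℝ d)

/-- Pointwise complex conjugation on `L²(S¹; ℂ)`, a real-linear map. -/
noncomputable def conjOp : L2 →L[ℝ] L2 :=
  (Complex.conjCLE : ℂ →L[ℝ] ℂ).compLpL 2 μ

/-- The real-linear operator `T c = conj(d⁻) · c - d⁺ · conj(c^{aps})` on `L²(S¹; ℂ)`. -/
noncomputable def T (dp dm : C(S1, ℂ)) : L2 →L[ℝ] L2 :=
  mulOp (star dm) - mulOp dp ∘L conjOp ∘L aps.restrictScalars ℝ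

lemma fourierCoeff_aps (c : L2) (l : ℤ) :
    fourierCoeff (aps c : S1 → ℂ) l = (l.sign : ℂ) * fourierCoeff (c : S1 → ℂ) l := by
  rw [← fourierBasis_repr, ← fourierBasis_repr]
  simp [aps, signMul]

lemma coeFn_T (dp dm : C(S1, ℂ)) (c : L2) :
    T dp dm c =ᵐ[μ] fun t =>
      (starRingEnd ℂ) (dm t) * c t - dp t * (starRingEnd ℂ) ((aps c : S1 → ℂ) t) := by
  have h1 : mulOp (star dm) c =ᵐ[μ] fun t => (starRingEnd ℂ) (dm t) * c t := by
    filter_upwards [ContinuousLinearMap.coeFn_holder (r := 2) (ContinuousLinearMap.mul ℝ ℂ)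
      (ContinuousMap.toLp ∞ μ ℝ (star dm)) c,
      ContinuousMap.coeFn_toLp (p := ∞) (𝕜 := ℝ) μ (star dm)] with t ht hs
    have hs' : (ContinuousMap.toLp ∞ μ ℝ (star dm) : S1 → ℂ) t = (starRingEnd ℂ) (dm t) := hs
    rw [← hs']
    exact ht
  have h2 : mulOp dp (conjOp (aps c)) =ᵐ[μ]
      fun t => dp t * (starRingEnd ℂ) ((aps c : S1 → ℂ) t) := by
    filter_upwards [ContinuousLinearMap.coeFn_holder (r := 2) (ContinuousLinearMap.mul ℝ ℂ)
      (ContinuousMap.toLp ∞ μ ℝ dp) (conjOp (aps c)),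
      ContinuousMap.coeFn_toLp (p := ∞) (𝕜 := ℝ) μ dp,
      ContinuousLinearMap.coeFn_compLpL (p := 2) (μ := μ)
        (Complex.conjCLE : ℂ →L[ℝ] ℂ) (aps c)] with t ht hs hc
    have hc' : (conjOp (aps c) : S1 → ℂ) t = (starRingEnd ℂ) ((aps c : S1 → ℂ) t) := hc
    rw [← hs, ← hc']
    exact ht
  filter_upwards [h1, h2, Lp.coeFn_sub (mulOp (star dm) c) (mulOp dp (conjOp (aps c)))]
    with t h1 h2 h3
  rw [← h1, ← h2]
  exact h3

/-- The index `dim ker T - dim coker T` of a Fredholm operator between real vector spaces. -/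
noncomputable def index {E F : Type*} [NormedAddCommGroup E] [NormedSpace ℝ E]
    [NormedAddCommGroup F] [NormedSpace ℝ F] (A : E →L[ℝ] F) : ℤ :=
  (Module.finrank ℝ A.ker : ℤ) - (Module.finrank ℝ (F ⧸ A.range) : ℤ)

end CircleOperator

/-! Modulo norm limits of finite rank operators, K : c ↦ conj(c^{aps}) satisfies K² = -1 and K f =
conj(f) K for every continuous f (`symK_mul_self`, `symK_mul_symM`). Classes f + gK therefore
multiply like quaternion-valued functions, and T has the symbol conj(d⁻) - d⁺K, which vanishes
nowhere. It remains to show that such a symbol is the class of an invertible operator: T is then a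
limit-of-finite-rank perturbation of that operator, hence Fredholm of index 0
(`isFredholm_and_index_of_liftsToUnit`).

If f has no zero, f + gK = f(1 + f⁻¹gK), and 1 + hK is joined to 1 by the invertible symbols 1 + shK
(`liftsToUnit_symM_add`). The general case reduces to this one: a dimension count, where C¹
regularity enters, gives a constant quaternion whose product with the symbol of T has a nowhere
vanishing first component (`exists_forall_conj_mul_add_ne_zero`). -/

namespace LinearMap

/-! ### Finite rank perturbations of invertible operators -/

variable {k V : Type*} [Field k] [AddCommGroup V] [Module k V]

/-- The endomorphism `1 + F` has equal nullity and corank when `F` has finite rank. -/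
lemma HasFiniteRange.finrank_ker_one_add {F : V →ₗ[k] V} (hF : F.HasFiniteRange) :
    Module.finrank k (ker (1 + F)) = Module.finrank k (V ⧸ range (1 + F)) := by
  have : Module.Finite k (range F) := Module.Finite.of_fg hF
  have hB : ∀ x ∈ range F, (1 + F) x ∈ range F := fun x hx =>
    add_mem hx (mem_range_self F x)
  -- Since ker(1 + F) ⊆ range F and V = range F + range(1 + F), kernel and cokernel of 1 + F are
  -- those of its restriction g to the finite-dimensional space range F, where rank-nullity applies.
  set g : range F →ₗ[k] range F := (1 + F).restrict hB with hg
  have hle : ker (1 + F) ≤ range F := fun x hx => by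
    have hx : x + F x = 0 := hx
    exact ⟨-x, by rw [map_neg]; exact (eq_neg_of_add_eq_zero_left hx).symm⟩
  have h1 : Module.finrank k (ker g) = Module.finrank k (ker (1 + F)) := by
    rw [hg, ker_restrict]
    exact (Submodule.comapSubtypeEquivOfLe hle).finrank_eq
  set q : range F →ₗ[k] V ⧸ range (1 + F) := (range (1 + F)).mkQ ∘ₗ (range F).subtype with hq
  have hqs : Function.Surjective q := fun y => by
    obtain ⟨x, rfl⟩ := Submodule.Quotient.mk_surjective _ y
    refine ⟨⟨-F x, neg_mem (mem_range_self F x)⟩, ?_⟩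
    refine (Submodule.Quotient.eq _).2 ⟨-x, ?_⟩
    simp [sub_eq_add_neg, add_comm]
  have hqk : ker q = range g := by
    ext ⟨w, hw⟩
    rw [mem_ker, hq, comp_apply, Submodule.mkQ_apply, Submodule.Quotient.mk_eq_zero]
    constructor
    · rintro ⟨x, hx⟩
      have hx' : x + F x = w := hx
      have hxm : x ∈ range F := by
        rw [← add_sub_cancel_right x (F x), hx']
        exact sub_mem hw (mem_range_self F x)
      exact ⟨⟨x, hxm⟩, Subtype.ext hx⟩
    · rintro ⟨x, hx⟩
      exact ⟨x, congrArg Subtype.val hx⟩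
  have h2 : Module.finrank k (range F ⧸ range g) = Module.finrank k (V ⧸ range (1 + F)) := by
    rw [← hqk]
    exact (q.quotKerEquivOfSurjective hqs).finrank_eq
  have h3 := (range g).finrank_quotient_add_finrank
  have h4 := g.finrank_range_add_finrank_ker
  omega

end LinearMap

namespace CircleOperator

section Fredholm

variable {E : Type*} [NormedAddCommGroup E] [NormedSpace ℝ E]

open scoped LinearMap.FiniteRangeSetoid in
-- U⁻¹ is an inverse of U + F up to finite rank, and U + F = U(1 + U⁻¹F) reduces the index to the
-- case of 1 plus finite rank.
lemma isFredholm_and_index_of_unit_add (U : (E →L[ℝ] E)ˣ) {F : E →L[ℝ] E}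
    (hF : (F : E →ₗ[ℝ] E).HasFiniteRange) :
    ((U : E →L[ℝ] E) + F).IsFredholm ∧ index ((U : E →L[ℝ] E) + F) = 0 := by
  set V : E →L[ℝ] E := ↑U⁻¹ with hV
  have hVU : V * ↑U = 1 := U.inv_mul
  have hUV : ↑U * V = 1 := U.mul_inv
  constructor
  · refine ContinuousLinearMap.IsFredholm.of_isQuasiInverse (v := V) ⟨?_, ?_⟩
    · refine LinearMap.FiniteRangeSetoid.equiv_iff_hasFiniteRange.2 ?_
      have : (V : E →ₗ[ℝ] E) ∘ₗ ((U : E →L[ℝ] E) + F : E →L[ℝ] E) - LinearMap.id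
          = (V : E →ₗ[ℝ] E) ∘ₗ (F : E →ₗ[ℝ] E) := by
        ext x
        have hx : V (U.1 x) = x := DFunLike.congr_fun hVU x
        simp [hx]
      rw [this]
      exact hF.comp_left _
    · refine LinearMap.FiniteRangeSetoid.equiv_iff_hasFiniteRange.2 ?_
      have : (((U : E →L[ℝ] E) + F : E →L[ℝ] E) : E →ₗ[ℝ] E) ∘ₗ (V : E →ₗ[ℝ] E) - LinearMap.id
          = (F : E →ₗ[ℝ] E) ∘ₗ (V : E →ₗ[ℝ] E) := by
        ext x
        have hx : U.1 (V x) = x := DFunLike.congr_fun hUV x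
        simp [hx]
      rw [this]
      exact hF.comp_right _
  · set B : E →ₗ[ℝ] E := 1 + (V : E →ₗ[ℝ] E) ∘ₗ (F : E →ₗ[ℝ] E) with hB
    set e : E ≃L[ℝ] E := ContinuousLinearEquiv.unitsEquiv ℝ E U with he
    have heB : (((U : E →L[ℝ] E) + F : E →L[ℝ] E) : E →ₗ[ℝ] E) =
        (e.toLinearEquiv : E →ₗ[ℝ] E) ∘ₗ B := by
      ext x
      have hx : U.1 (V (F x)) = F x := DFunLike.congr_fun hUV (F x)
      simp [he, hB, hx]
    have hk := (LinearMap.HasFiniteRange.comp_left hF (V : E →ₗ[ℝ] E)).finrank_ker_one_add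
    rw [index, heB, LinearEquiv.ker_comp, LinearMap.range_comp, hk, sub_eq_zero, Nat.cast_inj]
    exact (Submodule.Quotient.equiv _ _ e.toLinearEquiv rfl).finrank_eq

/-! ### The Calkin algebra and classes of invertible operators -/

variable (E) in
/-- The norm closure of the finite rank operators, a two-sided ideal. -/
def approximable : TwoSidedIdeal (E →L[ℝ] E) :=
  let S : Set (E →L[ℝ] E) := {A | (A : E →ₗ[ℝ] E).HasFiniteRange}
  .mk' (closure S)
    (subset_closure LinearMap.HasFiniteRange.zero)
    (fun {_ _} hx hy => map_mem_closure₂ continuous_add hx hy fun _ ha _ hb =>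
      LinearMap.HasFiniteRange.add ha hb)
    (fun {_} hx => map_mem_closure continuous_neg hx fun _ ha => LinearMap.HasFiniteRange.neg ha)
    (fun {x _} hy => map_mem_closure (continuous_const_mul x) hy fun _ ha =>
      LinearMap.HasFiniteRange.comp_left ha (x : E →ₗ[ℝ] E))
    (fun {_ y} hx => map_mem_closure (f := (· * y)) (continuous_mul_const y) hx fun _ ha =>
      LinearMap.HasFiniteRange.comp_right (v := (_ : E →ₗ[ℝ] E)) ha (y : E →ₗ[ℝ] E))

lemma mem_approximable {A : E →L[ℝ] E} :
    A ∈ approximable E ↔ A ∈ closure {A : E →L[ℝ] E | (A : E →ₗ[ℝ] E).HasFiniteRange} := by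
  rw [approximable, TwoSidedIdeal.mem_mk']

lemma mem_approximable_of_hasFiniteRange {A : E →L[ℝ] E}
    (hA : (A : E →ₗ[ℝ] E).HasFiniteRange) : A ∈ approximable E :=
  mem_approximable.2 (subset_closure hA)

variable (E) in
/-- The algebra of bounded operators modulo norm limits of finite rank operators. -/
abbrev Calkin : Type _ := (approximable E).ringCon.Quotient

variable (E) in
/-- The quotient map onto the Calkin algebra. -/
abbrev toCalkin : (E →L[ℝ] E) →+* Calkin E := (approximable E).ringCon.mk'

lemma toCalkin_eq_iff {A B : E →L[ℝ] E} : toCalkin E A = toCalkin E B ↔ A - B ∈ approximable E :=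
  (RingCon.eq _).trans (TwoSidedIdeal.rel_iff _ _ _)

/-- An element of the Calkin algebra that is represented by an invertible operator. -/
def LiftsToUnit (x : Calkin E) : Prop := ∃ U : (E →L[ℝ] E)ˣ, toCalkin E U = x

lemma LiftsToUnit.mul {x y : Calkin E} : LiftsToUnit x → LiftsToUnit y → LiftsToUnit (x * y) := by
  rintro ⟨U, rfl⟩ ⟨V, rfl⟩
  exact ⟨U * V, by simp⟩

lemma LiftsToUnit.of_mul_right {x y : Calkin E} :
    LiftsToUnit (x * y) → LiftsToUnit y → LiftsToUnit x := by
  rintro ⟨U, hU⟩ ⟨V, rfl⟩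
  refine ⟨U * V⁻¹, ?_⟩
  rw [Units.val_mul, map_mul, hU, mul_assoc, ← map_mul, Units.mul_inv, map_one, mul_one]

lemma liftsToUnit_of_isUnit {A : E →L[ℝ] E} (hA : IsUnit A) : LiftsToUnit (toCalkin E A) :=
  ⟨hA.unit, rfl⟩

variable [CompleteSpace E]

lemma liftsToUnit_one_add {X : E →L[ℝ] E} (hX : ‖X‖ < 1) : LiftsToUnit (1 + toCalkin E X) :=
  ⟨Units.oneSub (-X) (by rwa [norm_neg]), by simp⟩

/-- Invertibility is an open condition: a finite rank F close enough to A - U leaves A - F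
invertible, and A = (A - F) + F. -/
lemma isFredholm_and_index_of_liftsToUnit {A : E →L[ℝ] E} (hA : LiftsToUnit (toCalkin E A)) :
    A.IsFredholm ∧ index A = 0 := by
  obtain ⟨U, hU⟩ := hA
  have hmem := mem_approximable.1 (toCalkin_eq_iff.1 hU.symm)
  have hopen : ∀ᶠ G in nhds (A - U.1), IsUnit (A - G) := by
    have hc : ContinuousAt (fun G => A - G) (A - U.1) := by fun_prop
    refine hc.eventually ?_
    simp only [sub_sub_cancel]
    exact Units.isOpen.mem_nhds U.isUnit
  obtain ⟨F, hF, hFfin⟩ := (mem_closure_iff_frequently.1 hmem).and_eventually hopen |>.exists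
  have h := isFredholm_and_index_of_unit_add hFfin.unit hF
  rwa [IsUnit.unit_spec, sub_add_cancel] at h

end Fredholm

/-! ### Multiplication, conjugation and Fourier coefficients -/

lemma coeFn_mulOp (f : C(S1, ℂ)) (c : L2) : mulOp f c =ᵐ[μ] fun t => f t * c t := by
  filter_upwards [ContinuousLinearMap.coeFn_holder (r := 2) (ContinuousLinearMap.mul ℝ ℂ)
      (ContinuousMap.toLp ∞ μ ℝ f) c, ContinuousMap.coeFn_toLp (p := ∞) (𝕜 := ℝ) μ f] with t ht hs
  rw [← hs]
  exact ht

lemma coeFn_conjOp (c : L2) : conjOp c =ᵐ[μ] fun t => (starRingEnd ℂ) (c t) :=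
  ContinuousLinearMap.coeFn_compLpL (p := 2) (μ := μ) (Complex.conjCLE : ℂ →L[ℝ] ℂ) c

lemma mulOp_add (f g : C(S1, ℂ)) : mulOp (f + g) = mulOp f + mulOp g := by
  simp [mulOp]

lemma mulOp_smul (r : ℝ) (f : C(S1, ℂ)) : mulOp (r • f) = r • mulOp f := by
  simp [mulOp]

lemma mulOp_mul (f g : C(S1, ℂ)) : mulOp (f * g) = mulOp f * mulOp g := by
  ext1 c
  refine Lp.ext ?_
  filter_upwards [coeFn_mulOp (f * g) c, coeFn_mulOp f (mulOp g c), coeFn_mulOp g c]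
    with t h1 h2 h3
  change _ = (mulOp f (mulOp g c) : S1 → ℂ) t
  rw [h1, h2, h3, ContinuousMap.mul_apply, mul_assoc]

lemma mulOp_one : mulOp 1 = 1 := by
  ext1 c
  refine Lp.ext ?_
  filter_upwards [coeFn_mulOp 1 c] with t h1
  rw [h1, ContinuousMap.one_apply, one_mul, one_apply_eq_self]

lemma norm_mulOp_le (f : C(S1, ℂ)) : ‖mulOp f‖ ≤ ‖f‖ := by
  refine ContinuousLinearMap.opNorm_le_bound _ (norm_nonneg _) fun c => ?_
  refine Lp.norm_le_mul_norm_of_ae_le_mul ?_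
  filter_upwards [coeFn_mulOp f c] with t h
  rw [h, norm_mul]
  gcongr
  exact f.norm_coe_le_norm t

lemma isUnit_mulOp {f : C(S1, ℂ)} (hf : IsUnit f) : IsUnit (mulOp f) := by
  obtain ⟨u, rfl⟩ := hf
  exact ⟨⟨mulOp u, mulOp ↑u⁻¹, by rw [← mulOp_mul, u.mul_inv, mulOp_one],
    by rw [← mulOp_mul, u.inv_mul, mulOp_one]⟩, rfl⟩

lemma conjOp_mul_mulOp (f : C(S1, ℂ)) : conjOp * mulOp f = mulOp (star f) * conjOp := by
  ext1 c
  refine Lp.ext ?_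
  filter_upwards [coeFn_conjOp (mulOp f c), coeFn_mulOp f c, coeFn_mulOp (star f) (conjOp c),
    coeFn_conjOp c] with t h1 h2 h3 h4
  change (conjOp (mulOp f c) : S1 → ℂ) t = (mulOp (star f) (conjOp c) : S1 → ℂ) t
  rw [h1, h2, h3, h4, map_mul]
  rfl

lemma fourierCoeff_conjOp (c : L2) (l : ℤ) :
    fourierCoeff (conjOp c : S1 → ℂ) l = (starRingEnd ℂ) (fourierCoeff (c : S1 → ℂ) (-l)) := by
  rw [fourierCoeff_congr_ae (coeFn_conjOp c), fourierCoeff, fourierCoeff, ← integral_conj]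
  refine integral_congr_ae (ae_of_all _ fun t => ?_)
  simp only [smul_eq_mul, map_mul, ← fourier_neg, neg_neg]

lemma fourierCoeff_mulOp_fourier (n : ℤ) (c : L2) (l : ℤ) :
    fourierCoeff (mulOp (fourier n) c : S1 → ℂ) l = fourierCoeff (c : S1 → ℂ) (l - n) := by
  rw [fourierCoeff_congr_ae (coeFn_mulOp (fourier n) c), fourierCoeff, fourierCoeff]
  refine integral_congr_ae (ae_of_all _ fun t => ?_)
  simp only [smul_eq_mul]
  rw [neg_sub, sub_eq_neg_add, fourier_add, mul_assoc]

lemma fourierCoeff_coe_add (a b : L2) (l : ℤ) :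
    fourierCoeff ((a + b : L2) : S1 → ℂ) l =
      fourierCoeff (a : S1 → ℂ) l + fourierCoeff (b : S1 → ℂ) l := by
  simp only [← fourierBasis_repr, map_add]
  rfl

lemma fourierCoeff_coe_sub (a b : L2) (l : ℤ) :
    fourierCoeff ((a - b : L2) : S1 → ℂ) l =
      fourierCoeff (a : S1 → ℂ) l - fourierCoeff (b : S1 → ℂ) l := by
  simp only [← fourierBasis_repr, map_sub]
  rfl

/-- An operator whose values are trigonometric polynomials of bounded degree has finite rank. -/
lemma mem_approximable_of_fourierCoeff_eq_zero (A : L2 →L[ℝ] L2) (s : Finset ℤ)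
    (h : ∀ c, ∀ l ∉ s, fourierCoeff (A c : S1 → ℂ) l = 0) : A ∈ approximable L2 := by
  refine mem_approximable_of_hasFiniteRange ?_
  set W : Submodule ℂ L2 := Submodule.span ℂ ((fun l : ℤ => (fourierLp 2 l : L2)) '' s) with hW
  have hfin : FiniteDimensional ℂ W :=
    FiniteDimensional.span_of_finite ℂ (s.finite_toSet.image _)
  have hfin' : FiniteDimensional ℝ W := FiniteDimensional.complexToReal W
  have hfin'' : FiniteDimensional ℝ (W.restrictScalars ℝ) := hfin'
  have hle : LinearMap.range (A : L2 →ₗ[ℝ] L2) ≤ W.restrictScalars ℝ := by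
    rintro _ ⟨c, rfl⟩
    have hs := (hasSum_fourier_series_L2 (A c)).unique
      (hasSum_sum_of_ne_finset_zero (s := s) fun l hl => by rw [h c l hl, zero_smul])
    change A c ∈ W
    rw [hs]
    exact Submodule.sum_mem _ fun l hl =>
      Submodule.smul_mem _ _ (Submodule.subset_span ⟨l, hl, rfl⟩)
  have := Submodule.finiteDimensional_of_le hle
  exact (Submodule.fg_iff_finiteDimensional _).2 this

/-! ### Relations modulo norm limits of finite rank operators -/

/-- The real-linear operator `c ↦ conj(c^{aps})`. -/
noncomputable def apsConj : L2 →L[ℝ] L2 := conjOp ∘L aps.restrictScalars ℝ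

lemma T_eq (dp dm : C(S1, ℂ)) : T dp dm = mulOp (star dm) - mulOp dp * apsConj := rfl

lemma fourierCoeff_apsConj (c : L2) (l : ℤ) :
    fourierCoeff (apsConj c : S1 → ℂ) l =
      -(l.sign : ℂ) * (starRingEnd ℂ) (fourierCoeff (c : S1 → ℂ) (-l)) := by
  change fourierCoeff (conjOp (aps c) : S1 → ℂ) l = _
  rw [fourierCoeff_conjOp, fourierCoeff_aps, map_mul, Int.sign_neg]
  simp

/-- Conjugation exchanges the modes l and -l, whose signs are opposite, so the square is -1 on every
mode except l = 0, which it kills. -/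
lemma apsConj_mul_self_add_one_mem : apsConj * apsConj - (-1) ∈ approximable L2 := by
  refine mem_approximable_of_fourierCoeff_eq_zero _ {0} fun c l hl => ?_
  have hl : l ≠ 0 := by simpa using hl
  have h1 : (apsConj * apsConj - (-1)) c = apsConj (apsConj c) + c := by simp
  rw [h1, fourierCoeff_coe_add, fourierCoeff_apsConj, fourierCoeff_apsConj]
  rcases lt_or_gt_of_ne hl with h | h
  · simp [Int.sign_neg, Int.sign_eq_neg_one_of_neg h]
  · simp [Int.sign_neg, Int.sign_eq_one_of_pos h]

/-- The commutator of `aps` with multiplication by `f`. -/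
noncomputable def apsComm (f : C(S1, ℂ)) : L2 →L[ℝ] L2 :=
  aps.restrictScalars ℝ * mulOp f - mulOp f * aps.restrictScalars ℝ

lemma apsComm_apply (f : C(S1, ℂ)) (c : L2) :
    apsComm f c = aps (mulOp f c) - mulOp f (aps c) := rfl

/-- The commutator weights a shifted coefficient by sign(l) - sign(l - n), which vanishes for |l| >
|n|. -/
lemma apsComm_fourier_mem (n : ℤ) : apsComm (fourier n) ∈ approximable L2 := by
  refine mem_approximable_of_fourierCoeff_eq_zero _ (Finset.Icc (-|n|) |n|) fun c l hl => ?_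
  rw [apsComm_apply, fourierCoeff_coe_sub, fourierCoeff_aps, fourierCoeff_mulOp_fourier,
    fourierCoeff_mulOp_fourier, fourierCoeff_aps, sub_eq_zero]
  congr 2
  rw [Finset.mem_Icc, not_and_or, not_le, not_le] at hl
  have h1 := le_abs_self n
  have h2 := neg_abs_le n
  rcases hl with hl | hl
  · rw [Int.sign_eq_neg_one_of_neg (by omega), Int.sign_eq_neg_one_of_neg (by omega)]
  · rw [Int.sign_eq_one_of_pos (by omega), Int.sign_eq_one_of_pos (by omega)]

lemma mulOp_const_apply (a : ℂ) (c : L2) : mulOp (ContinuousMap.const S1 a) c = a • c := by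
  refine Lp.ext ?_
  filter_upwards [coeFn_mulOp (ContinuousMap.const S1 a) c, Lp.coeFn_smul a c] with t h1 h2
  rw [h1, h2]
  rfl

lemma continuous_mulOp : Continuous mulOp :=
  ((ContinuousLinearMap.mul ℝ ℂ).holderL μ ∞ 2 2).continuous.comp
    (ContinuousMap.toLp ∞ μ ℝ : C(S1, ℂ) →L[ℝ] Lp ℂ ∞ μ).continuous

lemma continuous_apsComm : Continuous apsComm :=
  (continuous_mulOp.const_mul _).sub (continuous_mulOp.mul_const _)

lemma apsComm_zero : apsComm 0 = 0 := by
  have h : mulOp 0 = 0 := by simpa using mulOp_smul 0 0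
  rw [apsComm, h, mul_zero, zero_mul, sub_zero]

lemma apsComm_add (f g : C(S1, ℂ)) : apsComm (f + g) = apsComm f + apsComm g := by
  rw [apsComm, apsComm, apsComm, mulOp_add, mul_add, add_mul, add_sub_add_comm]

/-- The ideal consists of real-linear operators; writing a complex scalar as a left factor makes it
absorb that scalar. -/
lemma apsComm_smul (a : ℂ) (f : C(S1, ℂ)) :
    apsComm (a • f) = mulOp (ContinuousMap.const S1 a) * apsComm f := by
  have ha : a • f = ContinuousMap.const S1 a * f := by ext; simp
  ext1 c
  change _ = mulOp (ContinuousMap.const S1 a) (apsComm f c)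
  have h (c : L2) : mulOp (a • f) c = a • mulOp f c := by
    rw [ha, mulOp_mul, ← mulOp_const_apply]; rfl
  rw [mulOp_const_apply, apsComm_apply, apsComm_apply, h, h, map_smul, smul_sub]

lemma apsComm_mem_approximable_of_mem_span {f : C(S1, ℂ)}
    (hf : f ∈ Submodule.span ℂ (Set.range (fourier : ℤ → C(S1, ℂ)))) :
    apsComm f ∈ approximable L2 := by
  induction hf using Submodule.span_induction with
  | mem f hf =>
    obtain ⟨n, rfl⟩ := hf
    exact apsComm_fourier_mem n
  | zero =>
    rw [apsComm_zero]
    exact TwoSidedIdeal.zero_mem _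
  | add f g _ _ hf hg =>
    rw [apsComm_add]
    exact TwoSidedIdeal.add_mem _ hf hg
  | smul a f _ hf =>
    rw [apsComm_smul]
    exact TwoSidedIdeal.mul_mem_left _ _ _ hf

/-- Trigonometric polynomials are uniformly dense, the commutator depends continuously on f, and the
ideal is closed. -/
lemma apsComm_mem_approximable (f : C(S1, ℂ)) : apsComm f ∈ approximable L2 := by
  have hf : f ∈ closure (Submodule.span ℂ (Set.range (fourier : ℤ → C(S1, ℂ))) : Set C(S1, ℂ)) := by
    rw [← Submodule.topologicalClosure_coe, span_fourier_closure_eq_top]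
    trivial
  rw [mem_approximable, ← closure_closure]
  refine map_mem_closure continuous_apsComm hf fun g hg => ?_
  rw [← mem_approximable]
  exact apsComm_mem_approximable_of_mem_span hg

/-! ### Quaternionic symbol calculus -/

/-- Multiplication by `f`, as an element of the Calkin algebra. -/
noncomputable def symM (f : C(S1, ℂ)) : Calkin L2 := toCalkin L2 (mulOp f)

/-- The class of `apsConj` in the Calkin algebra. -/
noncomputable def symK : Calkin L2 := toCalkin L2 apsConj

lemma symM_add (f g : C(S1, ℂ)) : symM (f + g) = symM f + symM g := by
  rw [symM, mulOp_add, map_add]; rfl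

lemma symM_mul (f g : C(S1, ℂ)) : symM (f * g) = symM f * symM g := by
  rw [symM, mulOp_mul, map_mul]; rfl

lemma symM_one : symM 1 = 1 := by
  rw [symM, mulOp_one, map_one]

lemma symK_mul_self : symK * symK = -1 := by
  rw [symK, ← map_mul, ← map_one (toCalkin L2), ← map_neg]
  exact toCalkin_eq_iff.2 apsConj_mul_self_add_one_mem

/-- Conjugation turns f into its conjugate exactly; the error from moving f past `aps` is the
negligible commutator. -/
lemma symK_mul_symM (f : C(S1, ℂ)) : symK * symM f = symM (star f) * symK := by
  rw [symK, symM, symM, ← map_mul, ← map_mul, toCalkin_eq_iff]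
  have h : apsConj * mulOp f - mulOp (star f) * apsConj = conjOp * apsComm f := by
    change conjOp * aps.restrictScalars ℝ * mulOp f -
      mulOp (star f) * (conjOp * aps.restrictScalars ℝ) = _
    rw [apsComm, mul_sub, ← mul_assoc, ← mul_assoc, ← mul_assoc, conjOp_mul_mulOp]
  rw [h]
  exact TwoSidedIdeal.mul_mem_left _ _ _ (apsComm_mem_approximable f)

lemma toCalkin_T (dp dm : C(S1, ℂ)) :
    toCalkin L2 (T dp dm) = symM (star dm) - symM dp * symK := by
  rw [T_eq, map_sub, map_mul]; rfl

lemma symM_sub (f g : C(S1, ℂ)) : symM (f - g) = symM f - symM g := by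
  rw [eq_sub_iff_add_eq, ← symM_add, sub_add_cancel]

lemma symM_neg (f : C(S1, ℂ)) : symM (-f) = -symM f := by
  rw [eq_neg_iff_add_eq_zero, ← symM_add, neg_add_cancel, ← sub_self (1 : C(S1, ℂ)), symM_sub,
    sub_self]

lemma symK_mul_symM_mul_symK (f : C(S1, ℂ)) : symK * (symM f * symK) = -symM (star f) := by
  rw [← mul_assoc, symK_mul_symM, mul_assoc, symK_mul_self, mul_neg_one]

/-- Multiplication of quaternion valued symbols. -/
lemma symbol_mul (a b u v : C(S1, ℂ)) :
    (symM a + symM b * symK) * (symM u + symM v * symK) =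
      symM (a * u - b * star v) + symM (a * v + b * star u) * symK := by
  have h1 : symM b * symK * symM u = symM b * symM (star u) * symK := by
    rw [mul_assoc, symK_mul_symM, mul_assoc]
  have h2 : symM b * symK * (symM v * symK) = -(symM b * symM (star v)) := by
    rw [mul_assoc, symK_mul_symM_mul_symK, mul_neg]
  rw [symM_sub, symM_add, symM_mul, symM_mul, symM_mul, symM_mul, add_mul, mul_add, mul_add, h1, h2,
    add_mul, ← mul_assoc]
  abel

/-! ### Deforming 1 + gK to 1 -/

/-- The function `1 / (1 + |f|²)`. -/
noncomputable def invOneAddNormSq (f : C(S1, ℂ)) : C(S1, ℂ) where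
  toFun t := (((1 + ‖f t‖ ^ 2)⁻¹ : ℝ) : ℂ)
  continuous_toFun := Complex.continuous_ofReal.comp <|
    Continuous.inv₀ (by fun_prop) fun t => by positivity

lemma one_add_mul_star_mul_invOneAddNormSq (f : C(S1, ℂ)) :
    (1 + f * star f) * invOneAddNormSq f = 1 := by
  ext t
  change (1 + f t * (starRingEnd ℂ) (f t)) * (((1 + ‖f t‖ ^ 2)⁻¹ : ℝ) : ℂ) = 1
  have h : (1 + ‖f t‖ ^ 2 : ℝ) ≠ 0 := by positivity
  rw [Complex.mul_conj, Complex.normSq_eq_norm_sq, ← Complex.ofReal_one, ← Complex.ofReal_add,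
    ← Complex.ofReal_mul, mul_inv_cancel₀ h]

lemma norm_invOneAddNormSq_le (f : C(S1, ℂ)) : ‖invOneAddNormSq f‖ ≤ 1 := by
  refine (ContinuousMap.norm_le _ zero_le_one).2 fun t => ?_
  change ‖(((1 + ‖f t‖ ^ 2)⁻¹ : ℝ) : ℂ)‖ ≤ 1
  rw [Complex.norm_real, Real.norm_of_nonneg (by positivity)]
  exact inv_le_one_of_one_le₀ (by simp)

/-- The inverse of 1 + fK is (1 - fK)(1 + |f|²)⁻¹, so 1 + (f + e)K = (1 + fK)(1 + X) with X this
inverse times eK. The admissible size of e depends on f only through ‖f‖. -/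
lemma LiftsToUnit.one_add_of_small {f e : C(S1, ℂ)}
    (hf : LiftsToUnit (1 + symM f * symK))
    (he : (1 + ‖f‖ * ‖apsConj‖) * (‖e‖ * ‖apsConj‖) < 1) :
    LiftsToUnit (1 + symM (f + e) * symK) := by
  set X : L2 →L[ℝ] L2 :=
    (1 - mulOp f * apsConj) * mulOp (invOneAddNormSq f) * (mulOp e * apsConj) with hX
  have hnorm : ‖X‖ < 1 := by
    refine lt_of_le_of_lt ?_ he
    have hone : ‖(1 : L2 →L[ℝ] L2)‖ ≤ 1 := ContinuousLinearMap.norm_id_le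
    have h1 : ‖1 - mulOp f * apsConj‖ ≤ 1 + ‖f‖ * ‖apsConj‖ :=
      (norm_sub_le _ _).trans (add_le_add hone ((norm_mul_le _ _).trans (by
        gcongr; exact norm_mulOp_le f)))
    have h2 : ‖mulOp (invOneAddNormSq f)‖ ≤ 1 :=
      (norm_mulOp_le _).trans (norm_invOneAddNormSq_le f)
    have h3 : ‖mulOp e * apsConj‖ ≤ ‖e‖ * ‖apsConj‖ :=
      (norm_mul_le _ _).trans (by gcongr; exact norm_mulOp_le e)
    calc ‖X‖ ≤ ‖1 - mulOp f * apsConj‖ * ‖mulOp (invOneAddNormSq f)‖ * ‖mulOp e * apsConj‖ :=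
          (norm_mul_le _ _).trans (by gcongr; exact norm_mul_le _ _)
      _ ≤ (1 + ‖f‖ * ‖apsConj‖) * 1 * (‖e‖ * ‖apsConj‖) := by gcongr
      _ = _ := by rw [mul_one]
  have hXc : toCalkin L2 X =
      (1 - symM f * symK) * symM (invOneAddNormSq f) * (symM e * symK) := by
    rw [hX, map_mul, map_mul, map_sub, map_one, map_mul, map_mul]; rfl
  have hquad : (1 + symM f * symK) * (1 - symM f * symK) * symM (invOneAddNormSq f) = 1 := by
    have h := symbol_mul 1 f 1 (-f)
    rw [symM_neg, neg_mul, ← sub_eq_add_neg, symM_one] at h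
    rw [h, star_neg, mul_neg, sub_neg_eq_add, mul_one, one_mul, star_one, mul_one, neg_add_cancel,
      ← sub_self (1 : C(S1, ℂ)), symM_sub, sub_self, zero_mul, add_zero, ← symM_mul,
      one_add_mul_star_mul_invOneAddNormSq, symM_one]
  have hfac : 1 + symM (f + e) * symK = (1 + symM f * symK) * (1 + toCalkin L2 X) := by
    rw [mul_add, mul_one, hXc, ← mul_assoc, ← mul_assoc (1 + symM f * symK), hquad, one_mul,
      symM_add, add_mul, add_assoc]
  rw [hfac]
  exact hf.mul (liftsToUnit_one_add hnorm)

lemma liftsToUnit_one_add_symM_mul_symK (g : C(S1, ℂ)) : LiftsToUnit (1 + symM g * symK) := by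
  -- The segment from 0 to g is cut into N equal steps. Every point on it has norm at most ‖g‖, so
  -- each step meets the smallness condition with the same bound C / N < 1.
  set C : ℝ := (1 + ‖g‖ * ‖apsConj‖) * (‖g‖ * ‖apsConj‖) with hC
  obtain ⟨N, hN⟩ := exists_nat_gt C
  have hN0 : (0 : ℝ) < N := lt_of_le_of_lt (by positivity) hN
  have key : ∀ n : ℕ, n ≤ N → LiftsToUnit (1 + symM (((n : ℝ) / N) • g) * symK) := by
    intro n
    induction n with
    | zero =>
      intro _
      have h0 : symM ((((0 : ℕ) : ℝ) / N) • g) = 0 := by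
        rw [Nat.cast_zero, zero_div, zero_smul, ← sub_self (1 : C(S1, ℂ)), symM_sub, sub_self]
      rw [h0, zero_mul, add_zero]
      exact ⟨1, map_one _⟩
    | succ n ih =>
      intro hn
      have hs : (((n + 1 : ℕ) : ℝ) / N) • g = ((n : ℝ) / N) • g + (1 / (N : ℝ)) • g := by
        rw [← add_smul, Nat.cast_add, Nat.cast_one, add_div]
      rw [hs]
      refine (ih (by omega)).one_add_of_small ?_
      have hle : (n : ℝ) / N ≤ 1 := (div_le_one hN0).2 (by exact_mod_cast (by omega : n ≤ N))
      have h1 : ‖((n : ℝ) / N) • g‖ ≤ ‖g‖ := by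
        rw [norm_smul, Real.norm_of_nonneg (by positivity)]
        exact mul_le_of_le_one_left (norm_nonneg g) hle
      have h2 : ‖(1 / (N : ℝ)) • g‖ = ‖g‖ / N := by
        rw [norm_smul, Real.norm_of_nonneg (by positivity), one_div_mul_eq_div]
      calc _ ≤ (1 + ‖g‖ * ‖apsConj‖) * (‖g‖ / N * ‖apsConj‖) := by rw [h2]; gcongr
        _ = C / N := by rw [hC]; ring
        _ < 1 := (div_lt_one hN0).2 hN
  have h := key N le_rfl
  rwa [div_self hN0.ne', one_smul] at h

lemma liftsToUnit_symM_add {f : C(S1, ℂ)} (hf : IsUnit f) (g : C(S1, ℂ)) :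
    LiftsToUnit (symM f + symM g * symK) := by
  obtain ⟨u, rfl⟩ := hf
  have h : symM u + symM g * symK = symM u * (1 + symM (↑u⁻¹ * g) * symK) := by
    rw [mul_add, mul_one, ← mul_assoc, ← symM_mul, ← mul_assoc, u.mul_inv, one_mul]
  rw [h]
  exact (liftsToUnit_of_isUnit (isUnit_mulOp u.isUnit)).mul (liftsToUnit_one_add_symM_mul_symK _)

/-! ### General position and conclusion -/

/-- A `C¹` curve of lines in `ℂ²` misses the direction of some vector with nonzero first
component. -/
lemma exists_forall_conj_mul_add_ne_zero {dp dm : C(S1, ℂ)} (hdp : IsC1 dp) (hdm : IsC1 dm)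
    (hd : ∀ t : S1, ‖dp t‖ ^ 2 + ‖dm t‖ ^ 2 ≠ 0) :
    ∃ u w : ℂ, u ≠ 0 ∧ ∀ t, (starRingEnd ℂ) (dm t) * u + dp t * w ≠ 0 := by
  -- For fixed t the bad vectors (u, w) form the complex line spanned by (d⁺, -conj d⁻). Together
  -- these lines are the image of a C¹ map from real dimension 3 to real dimension 4, whose
  -- complement is dense.
  set φ : ℝ × ℂ → ℂ × ℂ := fun p =>
    (p.2 * dp (p.1 : S1), p.2 * -Complex.conjCLE (dm (p.1 : S1))) with hφ
  have hdp' : ContDiff ℝ 1 fun p : ℝ × ℂ => dp (p.1 : S1) :=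
    ContDiff.comp (g := fun t : ℝ => dp (t : S1)) hdp contDiff_fst
  have hdm' : ContDiff ℝ 1 fun p : ℝ × ℂ => dm (p.1 : S1) :=
    ContDiff.comp (g := fun t : ℝ => dm (t : S1)) hdm contDiff_fst
  have hφc : ContDiff ℝ 1 φ :=
    (contDiff_snd.mul hdp').prodMk
      (contDiff_snd.mul (Complex.conjCLE.contDiff.comp hdm').neg)
  have hdense : Dense (Set.range φ)ᶜ := hφc.dense_compl_range_of_finrank_lt_finrank (by
    simp [Complex.finrank_real_complex])
  -- Requiring u ≠ 0 makes the constant quaternion itself a symbol with invertible first component.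
  obtain ⟨⟨u, w⟩, hu, hmem⟩ := hdense.exists_mem_open
    (isOpen_ne.preimage continuous_fst : IsOpen {p : ℂ × ℂ | p.1 ≠ 0}) ⟨(1, 0), one_ne_zero⟩
  refine ⟨u, w, hmem, fun t h0 => hu ?_⟩
  obtain ⟨t, rfl⟩ := QuotientAddGroup.mk_surjective t
  have hN := hd t
  set a := dp (t : S1) with ha
  set b := dm (t : S1) with hb
  change (starRingEnd ℂ) b * u + a * w = 0 at h0
  have hN' : a * (starRingEnd ℂ) a + b * (starRingEnd ℂ) b ≠ 0 := by
    rw [Complex.mul_conj, Complex.mul_conj, Complex.normSq_eq_norm_sq, Complex.normSq_eq_norm_sq]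
    exact_mod_cast hN
  -- The coefficient of the Hermitian projection of (u, w) onto (a, -conj b).
  refine ⟨(t, ((starRingEnd ℂ) a * u - b * w) /
    (a * (starRingEnd ℂ) a + b * (starRingEnd ℂ) b)), ?_⟩
  refine Prod.ext ?_ ?_
  · change _ / _ * a = u
    rw [div_mul_eq_mul_div, div_eq_iff hN']
    linear_combination (-b) * h0
  · change _ / _ * -(starRingEnd ℂ) b = w
    rw [div_mul_eq_mul_div, div_eq_iff hN']
    linear_combination (-(starRingEnd ℂ) a) * h0

/-- `T dp dm` is an invertible operator up to norm limits of finite rank operators. -/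
lemma liftsToUnit_toCalkin_T {dp dm : C(S1, ℂ)} (hdp : IsC1 dp) (hdm : IsC1 dm)
    (hd : ∀ t : S1, ‖dp t‖ ^ 2 + ‖dm t‖ ^ 2 ≠ 0) : LiftsToUnit (toCalkin L2 (T dp dm)) := by
  obtain ⟨u, w, hu, hne⟩ := exists_forall_conj_mul_add_ne_zero hdp hdm hd
  rw [toCalkin_T, sub_eq_add_neg, ← neg_mul, ← symM_neg]
  set U : C(S1, ℂ) := ContinuousMap.const S1 u
  -- The product formula conjugates the second component, so conj(w) is what yields conj(d⁻)u + d⁺w.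
  set V : C(S1, ℂ) := ContinuousMap.const S1 (star w)
  refine LiftsToUnit.of_mul_right (y := symM U + symM V * symK) ?_ ?_
  · rw [symbol_mul]
    refine liftsToUnit_symM_add ((ContinuousMap.isUnit_iff_forall_ne_zero _).2 fun t => ?_) _
    have h : (star dm * U - -dp * star V) t = (starRingEnd ℂ) (dm t) * u + dp t * w := by
      simp [U, V]
    rw [h]
    exact hne t
  · exact liftsToUnit_symM_add ((ContinuousMap.isUnit_iff_forall_ne_zero _).2 fun _ => hu) _

end CircleOperator

theorem theorem7p11 (dp dm : C(CircleOperator.S1, ℂ))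
    (hdp : CircleOperator.IsC1 dp) (hdm : CircleOperator.IsC1 dm)
    (hd : ∀ t : CircleOperator.S1, ‖dp t‖ ^ 2 + ‖dm t‖ ^ 2 ≠ 0) :
    (CircleOperator.T dp dm).IsFredholm ∧
      CircleOperator.index (CircleOperator.T dp dm) = 0 := by
  exact CircleOperator.isFredholm_and_index_of_liftsToUnit
    (CircleOperator.liftsToUnit_toCalkin_T hdp hdm hd)
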